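/- **Theorem 3 (Third Construction of ZCCS).** *Conventions.* For complex sequences $\mathbf u,\mathbf v$ of length $L$ and $\tau\in\mathbb Z$ let $\Theta(\mathbf u,\mathbf v)(\tau)=\sum u_i\,\overline{v_j}$, the sum being over all $0\le i,j<L$ with $j-i=\tau$. For two codes $\mathbf C=(\mathbf u^{\mathbf a})_{\mathbf a}$, $\mathbf D=(\mathbf v^{\mathbf a})_{\mathbf a}$, each consisting of $N$ sequences of length $L$ with the same index set, let $\Theta(\mathbf C,\mathbf D)(\tau)=\sum_{\mathbf a}\Theta(\mathbf u^{\mathbf a},\mathbf v^{\mathbf a})(\tau)$. A set of $M$ such codes is an $(M,N,L,Z)$-ZCCS if for all codes $\mathbf C,\mathbf D$ in it $\Theta(\mathbf C,\mathbf C)(0)=NL$, $\Theta(\mathbf C,\mathbf C)(\tau)=0$ for $0<|\tau|<Z$, and $\Theta(\mathbf C,\mathbf D)(\tau)=0$ for $\mathbf C\ne\mathbf D$ and $|\tau|<Z$. It is optimal if $M=N\lfloor L/Z\rfloor$, and binary if all entries of its sequences are $\pm1$. For a Boolean function $f:\{0,1\}^m\to\mathbb Z_2$ put $f_r=f(r_0,\dots,r_{m-1})$,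 where $r=\sum_i r_i2^i$, and let $\psi_j(f)=((-1)^{f_0},\dots,(-1)^{f_{j-1}})$ and $\psi^j(f)=((-1)^{f_{2^m-j}},\dots,(-1)^{f_{2^m-1}})$. For a bit $x$ write $\bar x=1-x$. *Data.* Let $m_1\ge5$ and $0\le k\le m_1-5$, and let $Q$ be a quadratic form over $\mathbb Z_2$ in the variables $z_0,\dots,z_{m_1-5}$. Let $G(Q)$ be the graph with vertices $0,\dots,m_1-5$ in which $i\ne j$ are joined iff $z_iz_j$ has a nonzero coefficient in $Q$. Suppose that there are vertices $p_0<p_1<\dots<p_{k-1}$ such that removing them, with all edges at them, from $G(Q)$ leaves a path, and let $\beta_1$ and $\beta_2$ be the two end vertices of this path (so $\beta_1=\beta_2$ iff the path has only one vertex). Let $d,d_i\in\mathbb Z_2$ and $$g=Q+\sum_{i=0}^{m_1-5}d_iz_i+d+\alpha+\beta,$$ $$\alpha=\bar z_{m_1-1}\bigl(\bar z_{m_1-4}(z_{m_1-3}+z_{m_1-2})+z_{m_1-2}z_{m_1-3}\bigr),$$ $$\beta=z_{\beta_1}\bigl(\bar z_{m_1-1}(z_{m_1-2}\bar z_{m_1-3}\bar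 z_{m_1-4}+z_{m_1-2}z_{m_1-3})+z_{m_1-1}\bar z_{m_1-2}\bar z_{m_1-3}\bigr).$$ For $\mathbf a=(a_0,\dots,a_{k-1},a)\in\{0,1\}^{k+1}$ and $0\le n<2^k$ with binary representation $(n_0,\dots,n_{k-1})$, put $$g^{\mathbf a,n}=g+\sum_{i=0}^{k-1}(a_i+n_i)z_{p_i}+a\,z_{\beta_2},\qquad s^{\mathbf a,n}=\bar g+\sum_{i=0}^{k-1}(a_i+n_i)\bar z_{p_i}+\bar a\,z_{\beta_2},$$ where $\bar g(z_0,\dots,z_{m_1-1})=g(\bar z_0,\dots,\bar z_{m_1-1})$. Let $\gamma=2^{m_1-1}+2^{m_1-3}$ and $$\mathbf C_n=\bigl\{(\psi_\gamma(g^{\mathbf a,n}),\psi_\gamma(g^{\mathbf a,n}),-\psi_\gamma(g^{\mathbf a,n})):\mathbf a\in\{0,1\}^{k+1}\bigr\},$$ $$\bar{\mathbf C}_n=\bigl\{(\psi^\gamma(s^{\mathbf a,n}),\psi^\gamma(s^{\mathbf a,n}),-\psi^\gamma(s^{\mathbf a,n})):\mathbf a\in\{0,1\}^{k+1}\bigr\},$$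 both indexed by $\mathbf a$. *Claim.* The code set $\{\mathbf C_n:0\le n<2^k\}\cup\{(\bar{\mathbf C}_n)^*:0\le n<2^k\}$, where $*$ is entrywise complex conjugation, is an optimal binary $(2^{k+1},2^{k+1},3\gamma,2\gamma)$-ZCCS. -/

import Mathlib

namespace ZCS

/-! ### Correlation and Z-complementary code sets -/

/-- The aperiodic cross-correlation sum `Θ(u, v)(τ)` of two complex sequences of length `L`:
the sum of `u_i * conj v_j` over all pairs of positions with `j = i + τ`.  For `0 ≤ τ < L` this is
`∑_{k=0}^{L-1-τ} u_k conj v_{k+τ}`, for `-L < τ < 0` it is `∑_{k=0}^{L+τ-1} u_{k-τ} conj v_k`, and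
for all other `τ` it is the empty sum `0`. -/
noncomputable def seqCorr {L : ℕ} (u v : Fin L → ℂ) (τ : ℤ) : ℂ :=
  ∑ i : Fin L, ∑ j : Fin L, if (j : ℤ) = (i : ℤ) + τ then u i * star (v j) else 0

/-- The aperiodic cross-correlation sum of two codes, that is, of two families of sequences of
length `L` with the same index set: the sum of the correlations of corresponding sequences. -/
noncomputable def codeCorr {κ : Type*} [Fintype κ] {L : ℕ} (C D : κ → Fin L → ℂ) (τ : ℤ) : ℂ :=
  ∑ a : κ, seqCorr (C a) (D a) τ

/-- `𝒞` is an `(M, N, L, Z)`-ZCCS: a set of `M` codes, each consisting of `N` sequences of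
length `L`, with the ideal correlations in the zone `|τ| < Z`. -/
def IsZCCS {κ : Type*} [Fintype κ] (M N L Z : ℕ) (𝒞 : Set (κ → Fin L → ℂ)) : Prop :=
  𝒞.encard = M ∧ Fintype.card κ = N ∧
    ∀ C ∈ 𝒞, ∀ D ∈ 𝒞, ∀ τ : ℤ,
      (C = D → τ = 0 → codeCorr C D τ = (N : ℂ) * (L : ℂ)) ∧
      (C = D → 0 < |τ| → |τ| < (Z : ℤ) → codeCorr C D τ = 0) ∧
      (C ≠ D → |τ| < (Z : ℤ) → codeCorr C D τ = 0)

/-- An `(M, N, L, Z)`-ZCCS is optimal if it attains the bound `M ≤ N * ⌊L / Z⌋`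
(the division below is the one of natural numbers, which rounds down). -/
def IsOptimalZCCS {κ : Type*} [Fintype κ] (M N L Z : ℕ) (𝒞 : Set (κ → Fin L → ℂ)) : Prop :=
  IsZCCS M N L Z 𝒞 ∧ 0 < Z ∧ M = N * (L / Z)

/-- A code set is binary if all entries of its sequences are `1` or `-1`. -/
def IsBinary {κ : Type*} {L : ℕ} (𝒞 : Set (κ → Fin L → ℂ)) : Prop :=
  ∀ C ∈ 𝒞, ∀ a i, C a i = 1 ∨ C a i = -1

/-! ### Boolean functions and their sequences -/

/-- Boolean functions of `m` variables, with `{0, 1}` identified with `ℤ/2`. -/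
abbrev BoolFun (m : ℕ) : Type := (Fin m → ZMod 2) → ZMod 2

/-- The binary representation `(r_0, …, r_{m-1})` of `r`, where `r = ∑ r_i 2^i` for `r < 2^m`. -/
def bits (m r : ℕ) : Fin m → ZMod 2 := fun i => if r.testBit i then 1 else 0

/-- `ω_2 = exp(2π√-1 / 2)`. -/
noncomputable def omega2 : ℂ := Complex.exp (2 * Real.pi * Complex.I / 2)

/-- The term `ω_2 ^ f_r`, with `f_r = f(r_0, …, r_{m-1}) ∈ {0, 1}`, of the sequence of `f`. -/
noncomputable def seqTerm {m : ℕ} (f : BoolFun m) (r : ℕ) : ℂ := omega2 ^ (f (bits m r)).val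

/-- The first `j` terms of the sequence of `f` (for `j ≤ 2 ^ m`). -/
noncomputable def firstTerms {m : ℕ} (j : ℕ) (f : BoolFun m) : Fin j → ℂ :=
  fun i => seqTerm f i

/-- The last `j` terms of the sequence of `f` (for `j ≤ 2 ^ m`). -/
noncomputable def lastTerms {m : ℕ} (j : ℕ) (f : BoolFun m) : Fin j → ℂ :=
  fun i => seqTerm f (2 ^ m - j + i)

/-! ### The graph of a quadratic form -/

/-- The graph of a quadratic form `Q` in `v` variables over `ℤ/2`: `i` and `j` are joined iff the
coefficient of `z_i z_j` in `Q`, which is `Q(e_i + e_j) - Q(e_i) - Q(e_j)`, is nonzero. -/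
def graph {v : ℕ} (Q : QuadraticForm (ZMod 2) (Fin v → ZMod 2)) : SimpleGraph (Fin v) where
  Adj i j := i ≠ j ∧ QuadraticMap.polar Q (Pi.single i 1) (Pi.single j 1) ≠ 0
  symm := ⟨fun i j h => ⟨h.1.symm, by rw [QuadraticMap.polar_comm]; exact h.2⟩⟩
  loopless := ⟨fun _ h => h.1 rfl⟩

/-- Removing the vertices in `S` from the graph `G` yields a (nonempty) path with the two end
vertices `x` and `y`; these coincide iff the path has a single vertex. -/
def IsPathAfterRemoving {V : Type*} (G : SimpleGraph V) (S : Set V) (x y : V) : Prop :=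
  ∃ (N : ℕ) (e : SimpleGraph.pathGraph (N + 1) ≃g G.induce Sᶜ),
    (e 0 : V) = x ∧ (e (Fin.last N) : V) = y

/-! ### The construction -/

/-- `γ = 2^(m-1) + 2^(m-3)`. -/
def gam (m : ℕ) : ℕ := 2 ^ (m - 1) + 2 ^ (m - 3)

section Construction

variable {m : ℕ} (hm : 5 ≤ m)

/-- The first `m - 4` variables `z_0, …, z_{m-5}`. -/
def low (z : Fin m → ZMod 2) : Fin (m - 4) → ZMod 2 :=
  fun i => z (Fin.castLE (Nat.sub_le m 4) i)

/-- The summand `α`; the complement of a bit `x` is `1 - x`. -/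
def alphaFun : BoolFun m := fun z =>
  let z₁ := z ⟨m - 1, by omega⟩
  let z₂ := z ⟨m - 2, by omega⟩
  let z₃ := z ⟨m - 3, by omega⟩
  let z₄ := z ⟨m - 4, by omega⟩
  (1 - z₁) * ((1 - z₄) * (z₃ + z₂) + z₂ * z₃)

/-- The summand `β`. -/
def betaFun (β₁ : Fin (m - 4)) : BoolFun m := fun z =>
  let z₁ := z ⟨m - 1, by omega⟩
  let z₂ := z ⟨m - 2, by omega⟩
  let z₃ := z ⟨m - 3, by omega⟩
  let z₄ := z ⟨m - 4, by omega⟩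
  low z β₁ * ((1 - z₁) * (z₂ * (1 - z₃) * (1 - z₄) + z₂ * z₃) + z₁ * (1 - z₂) * (1 - z₃))

/-- `g = Q + ∑_{i ≤ m-5} d_i z_i + d + α + β`. -/
def gFun (Q : QuadraticForm (ZMod 2) (Fin (m - 4) → ZMod 2)) (d : Fin (m - 4) → ZMod 2)
    (d' : ZMod 2) (β₁ : Fin (m - 4)) : BoolFun m := fun z =>
  Q (low z) + ∑ i, d i * low z i + d' + alphaFun hm z + betaFun hm β₁ z

/-- `g^{a,n} = g + ∑_α (a_α + n_α) z_{p_α} + a z_{β₂}` for `a = (a_0, …, a_{k-1}, a)`. -/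
def gShift {k : ℕ} (p : Fin k → Fin (m - 4)) (β₂ : Fin (m - 4)) (g : BoolFun m)
    (a : Fin (k + 1) → ZMod 2) (n : ℕ) : BoolFun m := fun z =>
  g z + ∑ i : Fin k, (a i.castSucc + bits k n i) * low z (p i) + a (Fin.last k) * low z β₂

/-- `s^{a,n} = ḡ + ∑_α (a_α + n_α) (1 - z_{p_α}) + (1 - a) z_{β₂}`, where
`ḡ(z_0, …, z_{m-1}) = g(1 - z_0, …, 1 - z_{m-1})`. -/
def sShift {k : ℕ} (p : Fin k → Fin (m - 4)) (β₂ : Fin (m - 4)) (g : BoolFun m)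
    (a : Fin (k + 1) → ZMod 2) (n : ℕ) : BoolFun m := fun z =>
  g (fun i => 1 - z i) + ∑ i : Fin k, (a i.castSucc + bits k n i) * (1 - low z (p i))
    + (1 - a (Fin.last k)) * low z β₂

/-- The concatenation `(x, x, -x)`: position `l * b + r` with `r < l` lies in block `b`. -/
def tripled {l : ℕ} (x : Fin l → ℂ) : Fin (3 * l) → ℂ :=
  fun i => (![1, 1, -1] : Fin 3 → ℂ) i.divNat * x i.modNat

/-- The code `C_n`, consisting of the sequences `(ψ_γ(g^{a,n}), ψ_γ(g^{a,n}), -ψ_γ(g^{a,n}))`. -/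
noncomputable def codeC {k : ℕ} (p : Fin k → Fin (m - 4)) (β₂ : Fin (m - 4)) (g : BoolFun m)
    (n : Fin (2 ^ k)) : (Fin (k + 1) → ZMod 2) → Fin (3 * gam m) → ℂ :=
  fun a => tripled (firstTerms (gam m) (gShift p β₂ g a n))

/-- The code `C̄_n`, consisting of the sequences `(ψ^γ(s^{a,n}), ψ^γ(s^{a,n}), -ψ^γ(s^{a,n}))`. -/
noncomputable def codeCbar {k : ℕ} (p : Fin k → Fin (m - 4)) (β₂ : Fin (m - 4)) (g : BoolFun m)
    (n : Fin (2 ^ k)) : (Fin (k + 1) → ZMod 2) → Fin (3 * gam m) → ℂ :=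
  fun a => tripled (lastTerms (gam m) (sShift p β₂ g a n))

/-- The code set `{C_n : 0 ≤ n < 2^k} ∪ {(C̄_n)^* : 0 ≤ n < 2^k}`, where `*` is entrywise complex
conjugation. -/
def codeSet {k : ℕ} (p : Fin k → Fin (m - 4)) (β₂ : Fin (m - 4)) (g : BoolFun m) :
    Set ((Fin (k + 1) → ZMod 2) → Fin (3 * gam m) → ℂ) :=
  Set.range (fun n => codeC p β₂ g n) ∪ Set.range (fun n => star (codeCbar p β₂ g n))

end Construction

end ZCS

namespace ZCS

open LaurentPolynomial

/-! ### The sign character of `ℤ/2` -/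

/-! All entries are real, so a correlation is a coefficient of a product of Laurent polynomials, one
factor having its exponents negated (`codeCorr_eq_coeff`). It suffices to compute these products
summed over `a`. The first γ positions form ten blocks of length `2 ^ (m - 4)`. On block `t` the top
four variables are constant, so `α` is a sign and `β` switches the term `z_{β₁}` on or off. The
generating polynomial is therefore `U(S) A₀ + V(S) A₁`, where `A₀`, `A₁` are the block polynomials
without and with `z_{β₁}` (`gen_firstTerms`). The blocks are completely complementary: summed over
`a`, the products of `A_e` for `n` with `A_e'` for `n'` vanish unless `e = e'` and `n = n'`, and are
constant then (`sum_blockGen_mul_blockGen`). This uses the path hypothesis. Since `U(S⁻¹) U(S) +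
V(S⁻¹) V(S) = 10`, the sequences of length γ have ideal correlations at every shift
(`sum_gen_firstTerms`). The pattern `(1, 1, -1)` multiplies this by `3 - x² - x⁻²` with `x = T γ`,
which leaves only the shifts `0` and `±2γ` (`tripleFactor_mul`). The second half of the code set
consists of signed reversals of the first half with the last coordinate of `a` flipped. Correlations
within it reduce to those of the first half (`sum_gen_codeCbar_codeCbar`); mixed ones cancel in
pairs under a translation of `a` (`sum_gen_mul_gen_flipLast`). -/

/-- The sign `(-1) ^ x`. -/
noncomputable def sgn (x : ZMod 2) : ℂ := (-1) ^ x.val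

theorem zmod_two_cases (x : ZMod 2) : x = 0 ∨ x = 1 := by
  revert x; decide

theorem zmod_two_eq_one {x : ZMod 2} (h : x ≠ 0) : x = 1 := (zmod_two_cases x).resolve_left h

@[simp] theorem sgn_zero : sgn 0 = 1 := by simp [sgn]

@[simp] theorem sgn_one : sgn 1 = -1 := by simp [sgn, ZMod.val_one]

theorem sgn_eq_one_or (x : ZMod 2) : sgn x = 1 ∨ sgn x = -1 := by
  rcases zmod_two_cases x with rfl | rfl <;> simp

theorem sgn_add (x y : ZMod 2) : sgn (x + y) = sgn x * sgn y := by
  rcases zmod_two_cases x with rfl | rfl <;> rcases zmod_two_cases y with rfl | rfl <;>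
    simp [CharTwo.add_self_eq_zero (1 : ZMod 2)]

theorem sgn_add_one (x : ZMod 2) : sgn (x + 1) = -sgn x := by simp [sgn_add]

theorem sgn_mul_self (x : ZMod 2) : sgn x * sgn x = 1 := by
  rw [← sgn_add, CharTwo.add_self_eq_zero, sgn_zero]

/-- A sum over a finite group vanishes if a translation changes the sign of the summand. -/
theorem sum_eq_zero_of_translate_neg {V M : Type*} [AddCommGroup V] [Fintype V] [AddCommGroup M]
    [Module ℂ M] (e : V) (f : V → M) (h : ∀ w, f (w + e) = -f w) : ∑ w, f w = 0 := by
  have h1 : ∑ w, f w = -∑ w, f w := by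
    conv_lhs => rw [← Equiv.sum_comp (Equiv.addRight e) f]
    simp [h]
  have h2 : (2 : ℂ) • ∑ w, f w = 0 := by
    rw [two_smul]
    nth_rewrite 1 [h1]
    exact neg_add_cancel _
  exact (smul_eq_zero.mp h2).resolve_left two_ne_zero

/-! ### Quadratic phases whose graph is a path up to some removed vertices -/

section Phase

variable {v k : ℕ}

/-- The integer with binary digits `w`. -/
def wt (w : Fin v → ZMod 2) : ℤ := ∑ i, ((w i).val : ℤ) * 2 ^ (i : ℕ)

/-- Digit `j` is the same in both positions, so flipping it in both preserves their distance. -/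
theorem wt_add_single_sub (w δ : Fin v → ZMod 2) (j : Fin v) (hj : δ j = 0) :
    wt (w + Pi.single j 1 + δ) - wt (w + Pi.single j 1) = wt (w + δ) - wt w := by
  simp only [wt, ← Finset.sum_sub_distrib]
  refine Finset.sum_congr rfl fun i _ => ?_
  by_cases h : i = j
  · subst h; simp [hj]
  · simp [h]

/-- The generating Laurent polynomial of the signs of `q`, with exponents scaled by `s`. -/
noncomputable def blockGen (s : ℤ) (q : (Fin v → ZMod 2) → ZMod 2) : LaurentPolynomial ℂ :=
  ∑ w, C (sgn (q w)) * T (s * wt w)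

/-- The quadratic phase of the sequences within a block. -/
def phase (Q : QuadraticForm (ZMod 2) (Fin v → ZMod 2)) (p : Fin k → Fin v) (β₁ β₂ : Fin v)
    (d : Fin v → ZMod 2) (d' : ZMod 2) (a : Fin (k + 1) → ZMod 2) (n : Fin k → ZMod 2)
    (e : ZMod 2) (w : Fin v → ZMod 2) : ZMod 2 :=
  Q w + ∑ i, d i * w i + d' + ∑ i : Fin k, (a i.castSucc + n i) * w (p i)
    + a (Fin.last k) * w β₂ + e * w β₁

variable (Q : QuadraticForm (ZMod 2) (Fin v → ZMod 2)) (p : Fin k → Fin v) (β₁ β₂ : Fin v)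
  (d : Fin v → ZMod 2) (d' : ZMod 2)

/-- The increment involves neither `n` nor `e`. When two phases with the same `a` are added,
everything but the difference of the polar terms cancels. -/
theorem phase_add_single (a : Fin (k + 1) → ZMod 2) (n : Fin k → ZMod 2) (e : ZMod 2)
    (w : Fin v → ZMod 2) (j : Fin v) (hjp : j ∉ Set.range p) (hj : j ≠ β₁) :
    phase Q p β₁ β₂ d d' a n e (w + Pi.single j 1) =
      phase Q p β₁ β₂ d d' a n e w +
        (Q (Pi.single j 1) + d j + a (Fin.last k) * (Pi.single j 1 : Fin v → ZMod 2) β₂) +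
        QuadraticMap.polar Q w (Pi.single j 1) := by
  have hp : ∀ i, p i ≠ j := fun i h => hjp ⟨i, h⟩
  have h1 : ∑ i, d i * (w + Pi.single j 1 : Fin v → ZMod 2) i = ∑ i, d i * w i + d j := by
    simp [mul_add, Finset.sum_add_distrib, Pi.single_apply]
  rw [phase, phase, QuadraticMap.map_add Q, h1]
  simp only [Pi.add_apply, Pi.single_eq_of_ne (hp _), Pi.single_eq_of_ne hj.symm, add_zero]
  ring

theorem polar_eq_sum (δ ε : Fin v → ZMod 2) :
    QuadraticMap.polar Q δ ε = ∑ i, δ i * QuadraticMap.polar Q (Pi.single i 1) ε := by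
  have h : δ = ∑ i, δ i • (Pi.single i 1 : Fin v → ZMod 2) := by
    ext j; simp [Pi.single_apply]
  conv_lhs => rw [h]
  rw [← QuadraticMap.polarBilin_apply_apply, map_sum, LinearMap.sum_apply]
  simp

/-- A direction in which translation changes the relative sign of a phase and its shift by `δ`. -/
theorem exists_polar_eq_one (hpath : IsPathAfterRemoving (graph Q) (Set.range p) β₁ β₂)
    (δ : Fin v → ZMod 2) (hδ : δ ≠ 0) (hδp : ∀ i, δ (p i) = 0) (hδβ : δ β₂ = 0) :
    ∃ j, j ∉ Set.range p ∧ j ≠ β₁ ∧ δ j = 0 ∧ QuadraticMap.polar Q δ (Pi.single j 1) = 1 := by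
  obtain ⟨N, e, he0, hel⟩ := hpath
  have hcover : ∀ x, δ x ≠ 0 → ∃ t, (e t : Fin v) = x := by
    intro x hx
    have : x ∈ (Set.range p)ᶜ := by
      rintro ⟨i, rfl⟩; exact hx (hδp i)
    exact ⟨e.symm ⟨x, this⟩, by simp⟩
  obtain ⟨x, hx⟩ := Function.ne_iff.mp hδ
  obtain ⟨t₀, ht₀⟩ := hcover x hx
  -- Take the last vertex of the path, going from `β₁` to `β₂`, in the support of `δ`. As `δ β₂ =
  -- 0`, it has a successor `j`, whose only other possible neighbour on the path lies beyond the
  -- support.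
  obtain ⟨t, ht, hmax⟩ := Finset.exists_max_image
    (Finset.univ.filter fun t : Fin (N + 1) => δ (e t) ≠ 0) id ⟨t₀, by simpa [ht₀] using hx⟩
  simp only [Finset.mem_filter, Finset.mem_univ, true_and, id] at ht hmax
  have htN : (t : ℕ) < N := by
    rcases (Fin.le_last t).lt_or_eq with h | h
    · exact h
    · rw [h, hel] at ht; exact absurd hδβ ht
  let j : Fin (N + 1) := ⟨t + 1, by omega⟩
  have hgt : ∀ s : Fin (N + 1), t < s → δ (e s) = 0 := by
    intro s hs
    by_contra h
    exact absurd (hmax s h) (not_le.mpr hs)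
  have hadj : ∀ s : Fin (N + 1), (graph Q).Adj (e s : Fin v) (e j : Fin v) ↔
      (SimpleGraph.pathGraph (N + 1)).Adj s j := by
    intro s
    rw [← e.map_adj_iff]
    rfl
  have hδj : δ (e j) = 0 := hgt j (by simp [j, Fin.lt_def])
  refine ⟨e j, (e j).2, ?_, hδj, ?_⟩
  · rw [← he0]
    intro h
    have := e.injective (Subtype.ext h)
    exact absurd (congrArg Fin.val this) (Nat.succ_ne_zero _)
  · rw [polar_eq_sum, Finset.sum_eq_single (e t : Fin v)]
    · have h1 := (hadj t).mpr (by rw [SimpleGraph.pathGraph_adj]; left; rfl)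
      rw [zmod_two_eq_one ht, zmod_two_eq_one h1.2, one_mul]
    · intro x _ hxt
      by_cases hx : δ x = 0
      · rw [hx, zero_mul]
      · obtain ⟨s, rfl⟩ := hcover x hx
        by_contra hne
        have hxj : (e s : Fin v) ≠ e j := fun h => hx (h ▸ hδj)
        have h1 := (hadj s).mp ⟨hxj, right_ne_zero_of_mul hne⟩
        rw [SimpleGraph.pathGraph_adj] at h1
        have hst : ¬ t < s := fun h => hx (hgt s h)
        have hne' : s ≠ t := fun h => hxt (by rw [h])
        simp only [j, Fin.lt_def, ne_eq, Fin.ext_iff] at h1 hst hne'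
        omega
    · simp

/-- The contribution of the shift `δ` to the summed correlation of the blocks. -/
noncomputable def shiftSum (n n' : Fin k → ZMod 2) (e e' : ZMod 2) (δ : Fin v → ZMod 2) :
    LaurentPolynomial ℂ :=
  ∑ a, ∑ w, C (sgn (phase Q p β₁ β₂ d d' a n e w + phase Q p β₁ β₂ d d' a n' e' (w + δ))) *
    T (wt (w + δ) - wt w)

/-- Pairs of positions are grouped by the bitwise difference `δ` of their digits, not by their
integer distance; cancellation takes place for each `δ` separately. -/
theorem sum_blockGen_eq_sum_shiftSum (n n' : Fin k → ZMod 2) (e e' : ZMod 2) :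
    ∑ a, blockGen (-1) (phase Q p β₁ β₂ d d' a n e) * blockGen 1 (phase Q p β₁ β₂ d d' a n' e') =
      ∑ δ, shiftSum Q p β₁ β₂ d d' n n' e e' δ := by
  simp only [shiftSum]
  rw [Finset.sum_comm]
  refine Finset.sum_congr rfl fun a _ => ?_
  rw [Finset.sum_comm, blockGen, blockGen, Finset.sum_mul_sum]
  refine Finset.sum_congr rfl fun w _ => ?_
  rw [← Equiv.sum_comp (Equiv.addLeft w)]
  refine Finset.sum_congr rfl fun δ _ => ?_
  simp only [Equiv.coe_addLeft, sgn_add, map_mul]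
  rw [show wt (w + δ) - wt w = -1 * wt w + 1 * wt (w + δ) by ring, T_add]
  ring

/-- A sign-reversing translation always exists: flip `a_i` if `δ` is nonzero at `p i`, flip the last
coordinate of `a` if `δ` is nonzero at `β₂`, and otherwise flip the digit of `w` supplied by
`exists_polar_eq_one`. -/
theorem shiftSum_eq_zero (hpath : IsPathAfterRemoving (graph Q) (Set.range p) β₁ β₂)
    (n n' : Fin k → ZMod 2) (e e' : ZMod 2) (δ : Fin v → ZMod 2) (hδ : δ ≠ 0) :
    shiftSum Q p β₁ β₂ d d' n n' e e' δ = 0 := by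
  by_cases h1 : ∃ i, δ (p i) ≠ 0
  · obtain ⟨i, hi⟩ := h1
    rw [shiftSum, Finset.sum_comm]
    refine Finset.sum_eq_zero fun w _ => ?_
    refine sum_eq_zero_of_translate_neg (Pi.single i.castSucc 1) _ fun a => ?_
    rw [← neg_mul, ← map_neg, ← sgn_add_one]
    congr 3
    have h2 : ∀ (n : Fin k → ZMod 2) (w : Fin v → ZMod 2),
        ∑ x : Fin k, ((a + Pi.single i.castSucc 1 : Fin (k + 1) → ZMod 2) x.castSucc + n x) *
          w (p x) = ∑ x : Fin k, (a x.castSucc + n x) * w (p x) + w (p i) := by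
      intro n w
      have : ∀ x : Fin k, (Pi.single i.castSucc 1 : Fin (k + 1) → ZMod 2) x.castSucc =
          if x = i then 1 else 0 := by
        intro x; simp [Pi.single_apply]
      simp only [Pi.add_apply, this, add_right_comm _ _ (n _)]
      simp [add_mul, Finset.sum_add_distrib]
    have h3 : (a + Pi.single i.castSucc 1 : Fin (k + 1) → ZMod 2) (Fin.last k) =
        a (Fin.last k) := by
      simp [Fin.ext_iff, i.2.ne']
    simp only [phase, h2, h3]
    have h4 : w (p i) + w (p i) = 0 := CharTwo.add_self_eq_zero _
    have h5 : (w + δ) (p i) = w (p i) + 1 := by rw [Pi.add_apply, zmod_two_eq_one hi]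
    rw [h5]
    linear_combination h4
  · push Not at h1
    by_cases h2 : δ β₂ = 0
    · obtain ⟨j, hjp, hj1, hj0, hj⟩ := exists_polar_eq_one Q p β₁ β₂ hpath δ hδ h1 h2
      refine Finset.sum_eq_zero fun a _ => ?_
      refine sum_eq_zero_of_translate_neg (Pi.single j 1) _ fun w => ?_
      rw [← neg_mul, ← map_neg, ← sgn_add_one, wt_add_single_sub w δ j hj0]
      congr 3
      rw [add_right_comm w, phase_add_single _ _ _ _ _ _ _ _ _ _ _ hjp hj1,
        phase_add_single _ _ _ _ _ _ _ _ _ _ _ hjp hj1, QuadraticMap.polar_add_left, hj]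
      linear_combination CharTwo.add_self_eq_zero
        (Q (Pi.single j 1) + d j + a (Fin.last k) * (Pi.single j 1 : Fin v → ZMod 2) β₂ +
          QuadraticMap.polar Q w (Pi.single j 1))
    · rw [shiftSum, Finset.sum_comm]
      refine Finset.sum_eq_zero fun w _ => ?_
      refine sum_eq_zero_of_translate_neg (Pi.single (Fin.last k) 1) _ fun a => ?_
      rw [← neg_mul, ← map_neg, ← sgn_add_one]
      congr 3
      have h3 : ∀ x : Fin k, (Pi.single (Fin.last k) 1 : Fin (k + 1) → ZMod 2) x.castSucc = 0 := by
        intro x; simp [Fin.ext_iff, x.2.ne]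
      simp only [phase, Pi.add_apply, h3, zmod_two_eq_one h2, Pi.single_eq_same]
      simp only [add_zero]
      linear_combination CharTwo.add_self_eq_zero (w β₂)

/-- For equal positions only a linear form in the digits at the `p i` and at `β₁` survives. These
vertices are distinct, so its character sum vanishes unless all coefficients do. -/
theorem shiftSum_zero (hp : Function.Injective p) (hβ : β₁ ∉ Set.range p)
    (n n' : Fin k → ZMod 2) (e e' : ZMod 2) :
    shiftSum Q p β₁ β₂ d d' n n' e e' 0 =
      if e = e' ∧ n = n' then C (2 ^ (k + 1) * 2 ^ v) else 0 := by
  have h0 : ∀ a w, phase Q p β₁ β₂ d d' a n e w + phase Q p β₁ β₂ d d' a n' e' w =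
      ∑ i, (n i + n' i) * w (p i) + (e + e') * w β₁ := by
    intro a w
    have h1 : ∑ i, (n i + n' i) * w (p i) =
        ∑ i : Fin k, (a i.castSucc + n i) * w (p i) +
          ∑ i : Fin k, (a i.castSucc + n' i) * w (p i) := by
      rw [← Finset.sum_add_distrib]
      refine Finset.sum_congr rfl fun i _ => ?_
      linear_combination -CharTwo.add_self_eq_zero (a i.castSucc * w (p i))
    rw [h1, phase, phase]
    linear_combination CharTwo.add_self_eq_zero (Q w + ∑ i, d i * w i + d' + a (Fin.last k) * w β₂)
  simp only [shiftSum, add_zero, sub_self, T_zero, mul_one, h0]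
  split_ifs with h
  · obtain ⟨rfl, rfl⟩ := h
    simp only [CharTwo.add_self_eq_zero, zero_mul, Finset.sum_const_zero, sgn_zero]
    simp [map_ofNat C 2]
  · refine Finset.sum_eq_zero fun a _ => ?_
    by_cases he : e = e'
    · have hn : n ≠ n' := fun hn => h ⟨he, hn⟩
      obtain ⟨i, hi⟩ := Function.ne_iff.mp hn
      refine sum_eq_zero_of_translate_neg (Pi.single (p i) 1) _ fun w => ?_
      rw [← map_neg, ← sgn_add_one]
      congr 2
      have h1 : ∀ x, (w + Pi.single (p i) 1 : Fin v → ZMod 2) (p x) =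
          w (p x) + if x = i then 1 else 0 := by
        intro x; simp [Pi.single_apply, hp.eq_iff]
      have h2 : n i + n' i = 1 := zmod_two_eq_one fun h => hi (CharTwo.add_eq_zero.mp h)
      simp only [h1, he, CharTwo.add_self_eq_zero, mul_add, Finset.sum_add_distrib]
      simp [h2]
    · refine sum_eq_zero_of_translate_neg (Pi.single β₁ 1) _ fun w => ?_
      rw [← map_neg, ← sgn_add_one]
      congr 2
      have h1 : ∀ x, (w + Pi.single β₁ 1 : Fin v → ZMod 2) (p x) = w (p x) := by
        intro x
        have : p x ≠ β₁ := fun hx => hβ ⟨x, hx⟩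
        simp [this]
      have h2 : e + e' = 1 := zmod_two_eq_one fun h => he (CharTwo.add_eq_zero.mp h)
      simp [h1, h2, add_assoc]

/-- The blocks form complete complementary codes. -/
theorem sum_blockGen_mul_blockGen (hpath : IsPathAfterRemoving (graph Q) (Set.range p) β₁ β₂)
    (hp : Function.Injective p) (n n' : Fin k → ZMod 2) (e e' : ZMod 2) :
    ∑ a, blockGen (-1) (phase Q p β₁ β₂ d d' a n e) * blockGen 1 (phase Q p β₁ β₂ d d' a n' e') =
      if e = e' ∧ n = n' then C (2 ^ (k + 1) * 2 ^ v) else 0 := by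
  have hβ : β₁ ∉ Set.range p := by
    obtain ⟨N, e, he0, -⟩ := hpath
    rw [← he0]; exact (e 0).2
  rw [sum_blockGen_eq_sum_shiftSum, Finset.sum_eq_single 0,
    shiftSum_zero Q p β₁ β₂ d d' hp hβ]
  · exact fun δ _ hδ => shiftSum_eq_zero Q p β₁ β₂ d d' hpath n n' e e' δ hδ
  · simp

end Phase

/-! ### Generating Laurent polynomials of sequences -/

/-- The generating Laurent polynomial of a sequence, with exponents scaled by `s`. -/
noncomputable def gen {L : ℕ} (s : ℤ) (u : Fin L → ℂ) : LaurentPolynomial ℂ :=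
  ∑ i, C (u i) * T (s * (i : ℕ))

theorem seqCorr_eq_coeff {L : ℕ} (u v : Fin L → ℂ) (hv : ∀ j, star (v j) = v j) (τ : ℤ) :
    seqCorr u v τ = (gen (-1) u * gen 1 v).coeff τ := by
  rw [gen, gen, Finset.sum_mul_sum, AddMonoidAlgebra.coeff_sum, Finset.sum_apply', seqCorr]
  refine Finset.sum_congr rfl fun i _ => ?_
  rw [AddMonoidAlgebra.coeff_sum, Finset.sum_apply']
  refine Finset.sum_congr rfl fun j _ => ?_
  have h : C (u i) * T (-1 * ((i : ℕ) : ℤ)) * (C (v j) * T (1 * ((j : ℕ) : ℤ))) =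
      (u i * v j) • (T ((j : ℤ) - i) : LaurentPolynomial ℂ) := by
    rw [smul_eq_C_mul, map_mul, show ((j : ℕ) : ℤ) - (i : ℕ) = -1 * (i : ℕ) + 1 * (j : ℕ) by ring,
      T_add]
    ring
  rw [h, AddMonoidAlgebra.coeff_smul, Finsupp.smul_apply, T_apply, hv, smul_eq_mul, mul_ite,
    mul_one, mul_zero]
  exact if_congr (by constructor <;> intro h <;> linarith) rfl rfl

theorem codeCorr_eq_coeff {κ : Type*} [Fintype κ] {L : ℕ} (c c' : κ → Fin L → ℂ)
    (hc : ∀ a j, star (c' a j) = c' a j) (τ : ℤ) :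
    codeCorr c c' τ = (∑ a, gen (-1) (c a) * gen 1 (c' a)).coeff τ := by
  rw [AddMonoidAlgebra.coeff_sum, Finset.sum_apply', codeCorr]
  exact Finset.sum_congr rfl fun a _ => seqCorr_eq_coeff _ _ (hc a) τ

/-- The generating Laurent polynomial of the pattern `(1, 1, -1)` with period `l`. -/
noncomputable def tripleFactor (s : ℤ) (l : ℕ) : LaurentPolynomial ℂ :=
  1 + T (s * l) - T (s * (2 * l))

theorem gen_tripled {l : ℕ} (s : ℤ) (x : Fin l → ℂ) :
    gen s (tripled x) = tripleFactor s l * gen s x := by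
  let F : Fin 3 × Fin l → LaurentPolynomial ℂ := fun q =>
    C ((![1, 1, -1] : Fin 3 → ℂ) q.1 * x q.2) * T (s * ((l : ℤ) * (q.1 : ℕ) + (q.2 : ℕ)))
  have h : ∀ i : Fin (3 * l), C (tripled x i) * T (s * (i : ℕ)) =
      F (finProdFinEquiv.symm i) := by
    intro i
    have h1 : (i : ℕ) = l * (i.divNat : ℕ) + (i.modNat : ℕ) := by
      rw [Fin.coe_divNat, Fin.coe_modNat, Nat.div_add_mod]
    simp only [F, finProdFinEquiv_symm_apply, tripled]
    congr 3
    exact_mod_cast h1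
  rw [gen, Finset.sum_congr rfl fun i _ => h i]
  refine (Equiv.sum_comp finProdFinEquiv.symm F).trans ?_
  have hF : ∀ b : Fin 3, ∑ r, F (b, r) =
      C ((![1, 1, -1] : Fin 3 → ℂ) b) * T (s * ((l : ℤ) * (b : ℕ))) * gen s x := by
    intro b
    rw [gen, Finset.mul_sum]
    refine Finset.sum_congr rfl fun r _ => ?_
    simp only [F, map_mul, mul_add, T_add]
    ring
  rw [Fintype.sum_prod_type, Fin.sum_univ_three, hF, hF, hF, tripleFactor]
  have h2 : (l : ℤ) * ((2 : Fin 3) : ℕ) = 2 * l := by simp [mul_comm]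
  rw [h2]
  simp [-T_mul]
  ring

/-- The pattern `(1, 1, -1)` has correlation `1 - 1 = 0` at lag one; this makes the zone as wide as
`2l`. -/
theorem tripleFactor_mul (l : ℕ) :
    tripleFactor (-1) l * tripleFactor 1 l = 3 - T (2 * (l : ℤ)) - T (-(2 * (l : ℤ))) := by
  have h : (T (-(l : ℤ)) * T (l : ℤ) : LaurentPolynomial ℂ) = 1 := by
    rw [← T_add, neg_add_cancel, T_zero]
  have h2 : (T (2 * (l : ℤ)) : LaurentPolynomial ℂ) = T (l : ℤ) ^ 2 := by simp
  have h3 : (T (-(2 * (l : ℤ))) : LaurentPolynomial ℂ) = T (-(l : ℤ)) ^ 2 := by simp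
  simp only [tripleFactor, one_mul, neg_one_mul, h2, h3]
  linear_combination (2 + T (-(l : ℤ)) * T (l : ℤ) - T (-(l : ℤ)) - T (l : ℤ)) * h

theorem gen_rev {L : ℕ} (s : ℤ) (c : ℂ) (u : Fin L → ℂ) :
    gen s (fun i => c * u i.rev) = C c * T (s * (L - 1)) * gen (-s) u := by
  rw [gen, gen, ← Equiv.sum_comp Fin.revPerm, Finset.mul_sum]
  refine Finset.sum_congr rfl fun i _ => ?_
  have h : s * ((Fin.rev i : Fin L) : ℕ) = s * (L - 1) + -s * (i : ℕ) := by
    rw [Fin.val_rev]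
    have := i.2
    push_cast [Nat.cast_sub (show (i : ℕ) + 1 ≤ L by omega)]
    ring
  simp only [Fin.revPerm_apply, Fin.rev_rev, h, T_add, map_mul]
  ring

/-! ### Sums over binary digits -/

theorem sum_range_mul {M : Type*} [AddCommMonoid M] (f : ℕ → M) (b t : ℕ) :
    ∑ i ∈ Finset.range (b * t), f i =
      ∑ j ∈ Finset.range t, ∑ r ∈ Finset.range b, f (b * j + r) := by
  induction t with
  | zero => simp
  | succ t ih => rw [Nat.mul_succ, Finset.sum_range_add, ih, Finset.sum_range_succ]

theorem wt_bits (v r : ℕ) (hr : r < 2 ^ v) : wt (bits v r) = r := by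
  -- Reducing modulo `2 ^ v` lets the induction run without the bound on `r`.
  have h : ∀ v, wt (bits v r) = (r % 2 ^ v : ℕ) := by
    intro v
    induction v with
    | zero => simp [wt, Nat.mod_one]
    | succ v ih =>
      have h1 : wt (bits (v + 1) r) = wt (bits v r) + (r.testBit v).toNat * 2 ^ v := by
        rw [wt, Fin.sum_univ_castSucc]
        congr 1
        cases h : r.testBit v <;> simp [bits, h, ZMod.val_one]
      rw [h1, ih, Nat.mod_pow_succ, Nat.toNat_testBit]
      push_cast
      ring
  rw [h, Nat.mod_eq_of_lt hr]

theorem bits_injective {v r r' : ℕ} (hr : r < 2 ^ v) (hr' : r' < 2 ^ v)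
    (h : bits v r = bits v r') : r = r' := by
  have := wt_bits v r hr
  rw [h, wt_bits v r' hr'] at this
  exact_mod_cast this.symm

theorem blockGen_eq_sum_range {v : ℕ} (s : ℤ) (q : (Fin v → ZMod 2) → ZMod 2) :
    blockGen s q = ∑ r ∈ Finset.range (2 ^ v), C (sgn (q (bits v r))) * T (s * r) := by
  have hb : Function.Bijective fun r : Fin (2 ^ v) => bits v r := by
    rw [Fintype.bijective_iff_injective_and_card]
    exact ⟨fun r r' h => Fin.ext (bits_injective r.2 r'.2 h), by simp⟩
  rw [blockGen, ← hb.sum_comp,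
    ← Fin.sum_univ_eq_sum_range fun r => C (sgn (q (bits v r))) * T (s * r)]
  exact Finset.sum_congr rfl fun r _ => by rw [wt_bits v r r.2]

theorem bits_compl {m r : ℕ} (hr : r < 2 ^ m) :
    bits m (2 ^ m - (r + 1)) = fun i => 1 - bits m r i := by
  ext i
  rw [bits, Nat.testBit_two_pow_sub_succ hr, bits]
  cases r.testBit i <;> simp

theorem seqTerm_eq_sgn {m : ℕ} (f : BoolFun m) (r : ℕ) : seqTerm f r = sgn (f (bits m r)) := by
  rw [seqTerm, sgn, omega2, show (2 * Real.pi * Complex.I / 2 : ℂ) = Real.pi * Complex.I by ring,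
    Complex.exp_pi_mul_I]

/-- The truncation at γ thus falls on a block boundary, after `8 + 2` blocks. -/
theorem gam_eq {m : ℕ} (hm : 5 ≤ m) : gam m = 2 ^ (m - 4) * 10 := by
  obtain ⟨n, rfl⟩ := Nat.exists_eq_add_of_le hm
  rw [gam, show 5 + n - 1 = n + 4 by omega, show 5 + n - 3 = n + 2 by omega,
    show 5 + n - 4 = n + 1 by omega]
  ring

theorem gam_lt {m : ℕ} (hm : 5 ≤ m) : gam m < 2 ^ m := by
  have h : 2 ^ m = 2 ^ (m - 4) * 16 := by
    rw [show (16 : ℕ) = 2 ^ 4 by norm_num, ← pow_add, Nat.sub_add_cancel (by omega)]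
  have := Nat.two_pow_pos (m - 4)
  rw [gam_eq hm]
  omega

/-! ### Block structure of the sequences -/

/-- The constant term of `g` in block `t`. -/
def blockConst (t : ℕ) : ZMod 2 :=
  (1 - bits 4 t 3) * ((1 - bits 4 t 0) * (bits 4 t 1 + bits 4 t 2) + bits 4 t 2 * bits 4 t 1)

/-- The coefficient of `z_{β₁}` in block `t`. -/
def blockCoeff (t : ℕ) : ZMod 2 :=
  (1 - bits 4 t 3) * (bits 4 t 2 * (1 - bits 4 t 1) * (1 - bits 4 t 0) + bits 4 t 2 * bits 4 t 1) +
    bits 4 t 3 * (1 - bits 4 t 2) * (1 - bits 4 t 1)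

section Construction

variable {m k : ℕ} (hm : 5 ≤ m) (Q : QuadraticForm (ZMod 2) (Fin (m - 4) → ZMod 2))
  (p : Fin k → Fin (m - 4)) (β₁ β₂ : Fin (m - 4)) (d : Fin (m - 4) → ZMod 2) (d' : ZMod 2)

theorem bits_block {t r : ℕ} (hr : r < 2 ^ (m - 4)) (j : Fin 4) (i : ℕ) (hi : i < m)
    (hij : i = m - 4 + j) : bits m (2 ^ (m - 4) * t + r) ⟨i, hi⟩ = bits 4 t j := by
  subst hij
  have h : (2 ^ (m - 4) * t + r).testBit (m - 4 + j) = t.testBit j := by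
    rw [Nat.testBit_two_pow_mul_add _ hr, if_neg (by omega), Nat.add_sub_cancel_left]
  simp only [bits, h]

theorem low_block {t r : ℕ} (hr : r < 2 ^ (m - 4)) :
    low (bits m (2 ^ (m - 4) * t + r)) = bits (m - 4) r := by
  ext i
  have h : (2 ^ (m - 4) * t + r).testBit i = r.testBit i := by
    rw [Nat.testBit_two_pow_mul_add _ hr, if_pos i.2]
  simp only [low, bits, Fin.val_castLE, h]

theorem gShift_block (a : Fin (k + 1) → ZMod 2) (n : ℕ) {t r : ℕ} (hr : r < 2 ^ (m - 4)) :
    gShift p β₂ (gFun hm Q d d' β₁) a n (bits m (2 ^ (m - 4) * t + r)) =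
      phase Q p β₁ β₂ d d' a (bits k n) (blockCoeff t) (bits (m - 4) r) + blockConst t := by
  have h1 := bits_block (m := m) (t := t) hr 3 (m - 1) (by omega) (by simp; omega)
  have h2 := bits_block (m := m) (t := t) hr 2 (m - 2) (by omega) (by simp; omega)
  have h3 := bits_block (m := m) (t := t) hr 1 (m - 3) (by omega) (by simp; omega)
  have h4 := bits_block (m := m) (t := t) hr 0 (m - 4) (by omega) (by simp)
  simp only [gShift, gFun, alphaFun, betaFun, h1, h2, h3, h4, low_block hr, phase, blockCoeff,
    blockConst]
  ring

/-- The exponents of `S` are block indices: the first factor collects the blocks with `blockCoeff t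
= 0`, the second those with `blockCoeff t = 1`, with signs given by `blockConst t`. Keeping `S` a
variable makes the bookkeeping polynomial algebra. -/
theorem gen_firstTerms (s : ℤ) (a : Fin (k + 1) → ZMod 2) (n : ℕ)
    (S : LaurentPolynomial ℂ) (hS : S = T (s * (2 ^ (m - 4) : ℕ))) :
    gen s (firstTerms (gam m) (gShift p β₂ (gFun hm Q d d' β₁) a n)) =
      (1 + S - S ^ 2 + S ^ 3 + S ^ 5) * blockGen s (phase Q p β₁ β₂ d d' a (bits k n) 0) +
      (-S ^ 4 - S ^ 6 - S ^ 7 + S ^ 8 + S ^ 9) *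
        blockGen s (phase Q p β₁ β₂ d d' a (bits k n) 1) := by
  have hblock : ∀ t : ℕ, ∑ r ∈ Finset.range (2 ^ (m - 4)),
      C (seqTerm (gShift p β₂ (gFun hm Q d d' β₁) a n) (2 ^ (m - 4) * t + r)) *
        T (s * (2 ^ (m - 4) * t + r : ℕ)) =
      C (sgn (blockConst t)) * S ^ t *
        blockGen s (phase Q p β₁ β₂ d d' a (bits k n) (blockCoeff t)) := by
    intro t
    rw [blockGen_eq_sum_range, Finset.mul_sum]
    refine Finset.sum_congr rfl fun r hr => ?_
    rw [seqTerm_eq_sgn, gShift_block _ _ _ _ _ _ _ _ _ (Finset.mem_range.mp hr), sgn_add, map_mul,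
      hS, T_pow, show s * ((2 ^ (m - 4) * t + r : ℕ) : ℤ) =
        t * (s * (2 ^ (m - 4) : ℕ)) + s * r by push_cast; ring, T_add]
    ring
  have hc : (blockConst 0 = 0 ∧ blockConst 1 = 0 ∧ blockConst 2 = 1 ∧ blockConst 3 = 0 ∧
      blockConst 4 = 1) ∧ blockConst 5 = 0 ∧ blockConst 6 = 1 ∧ blockConst 7 = 1 ∧
      blockConst 8 = 0 ∧ blockConst 9 = 0 := by decide
  have he : (blockCoeff 0 = 0 ∧ blockCoeff 1 = 0 ∧ blockCoeff 2 = 0 ∧ blockCoeff 3 = 0 ∧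
      blockCoeff 4 = 1) ∧ blockCoeff 5 = 0 ∧ blockCoeff 6 = 1 ∧ blockCoeff 7 = 1 ∧
      blockCoeff 8 = 1 ∧ blockCoeff 9 = 1 := by decide
  simp only [gen, firstTerms]
  rw [Fin.sum_univ_eq_sum_range fun i =>
    C (seqTerm (gShift p β₂ (gFun hm Q d d' β₁) a n) i) * T (s * (i : ℕ)), gam_eq hm,
    sum_range_mul, Finset.sum_congr rfl fun t _ => hblock t]
  simp only [Finset.sum_range_succ, Finset.sum_range_zero, hc, he, sgn_zero, sgn_one, map_neg,
    map_one]
  ring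

theorem sum_gen_firstTerms (hpath : IsPathAfterRemoving (graph Q) (Set.range p) β₁ β₂)
    (hp : Function.Injective p) (n n' : Fin (2 ^ k)) :
    ∑ a, gen (-1) (firstTerms (gam m) (gShift p β₂ (gFun hm Q d d' β₁) a n)) *
        gen 1 (firstTerms (gam m) (gShift p β₂ (gFun hm Q d d' β₁) a n')) =
      if n = n' then C (2 ^ (k + 1) * (gam m : ℂ)) else 0 := by
  obtain ⟨S, hS⟩ : ∃ S : LaurentPolynomial ℂ, S = T (1 * (2 ^ (m - 4) : ℕ)) := ⟨_, rfl⟩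
  obtain ⟨S', hS'⟩ : ∃ S' : LaurentPolynomial ℂ, S' = T (-1 * (2 ^ (m - 4) : ℕ)) := ⟨_, rfl⟩
  have hSS : S' * S = 1 := by
    rw [hS, hS', ← T_add, ← add_mul, neg_add_cancel, zero_mul, T_zero]
  have hb := fun e e' => sum_blockGen_mul_blockGen Q p β₁ β₂ d d' hpath hp (bits k n) (bits k n')
    e e'
  have hn : bits k n = bits k n' ↔ n = n' :=
    ⟨fun h => Fin.ext (bits_injective n.2 n'.2 h), fun h => by rw [h]⟩
  have h00 := hb 0 0
  have h01 := hb 0 1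
  have h10 := hb 1 0
  have h11 := hb 1 1
  simp only [true_and, hn, zero_ne_one, one_ne_zero, false_and, if_false] at h00 h01 h10 h11
  -- The two block patterns have disjoint supports of five blocks each and form a complementary
  -- pair; all nonzero lags cancel. This is what the choice of `α` and `β` achieves.
  have hgolay : (1 + S' - S' ^ 2 + S' ^ 3 + S' ^ 5) * (1 + S - S ^ 2 + S ^ 3 + S ^ 5) +
      (-S' ^ 4 - S' ^ 6 - S' ^ 7 + S' ^ 8 + S' ^ 9) * (-S ^ 4 - S ^ 6 - S ^ 7 + S ^ 8 + S ^ 9) =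
      10 := by
    grind
  simp only [gen_firstTerms hm Q p β₁ β₂ d d' (-1) _ _ S' hS',
    gen_firstTerms hm Q p β₁ β₂ d d' 1 _ _ S hS]
  -- The patterns become opaque, so that distributing products produces only the four block terms.
  generalize 1 + S' - S' ^ 2 + S' ^ 3 + S' ^ 5 = U' at hgolay ⊢
  generalize 1 + S - S ^ 2 + S ^ 3 + S ^ 5 = U at hgolay ⊢
  generalize -S' ^ 4 - S' ^ 6 - S' ^ 7 + S' ^ 8 + S' ^ 9 = V' at hgolay ⊢
  generalize -S ^ 4 - S ^ 6 - S ^ 7 + S ^ 8 + S ^ 9 = V at hgolay ⊢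
  simp only [add_mul, mul_add, Finset.sum_add_distrib]
  simp only [mul_mul_mul_comm _ (blockGen (-1) _), ← Finset.mul_sum, h00, h01, h10, h11, mul_zero,
    add_zero, zero_add]
  rw [← add_mul, hgolay]
  split_ifs
  · rw [gam_eq hm, show (10 : LaurentPolynomial ℂ) = C 10 by rw [map_ofNat], ← map_mul]
    congr 1
    push_cast
    ring
  · simp

/-- Complementing the last coordinate. -/
def flipLast (a : Fin (k + 1) → ZMod 2) : Fin (k + 1) → ZMod 2 := a + Pi.single (Fin.last k) 1

/-- Complementing all digits sends `r` to `2 ^ m - 1 - r`, hence the last γ positions to the first γ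
in reverse. The sign and the flip come from `(1 - a) z = (1 - a) + (a + 1)(1 - z)` over `ZMod 2`. -/
theorem lastTerms_sShift (hm : 5 ≤ m) (g : BoolFun m) (a : Fin (k + 1) → ZMod 2) (n : ℕ) (i : Fin (gam m)) :
    lastTerms (gam m) (sShift p β₂ g a n) i =
      sgn (1 - a (Fin.last k)) * firstTerms (gam m) (gShift p β₂ g (flipLast a) n) i.rev := by
  have h1 : 2 ^ m - gam m + i = 2 ^ m - ((i.rev : ℕ) + 1) := by
    have := gam_lt hm
    have := i.2
    rw [Fin.val_rev]
    omega
  have h2 : (i.rev : ℕ) < 2 ^ m := i.rev.2.trans (gam_lt hm)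
  have h3 : ∀ x : Fin k, (Pi.single (Fin.last k) 1 : Fin (k + 1) → ZMod 2) x.castSucc = 0 := by
    intro x; simp [Fin.ext_iff, x.2.ne]
  have h4 : ∀ x, low (fun i' => 1 - bits m (i.rev : ℕ) i') x = 1 - low (bits m (i.rev : ℕ)) x :=
    fun _ => rfl
  rw [lastTerms, firstTerms, h1, seqTerm_eq_sgn, seqTerm_eq_sgn, bits_compl h2, ← sgn_add]
  congr 1
  simp only [sShift, gShift, flipLast, h4, sub_sub_cancel, Pi.add_apply, h3, Pi.single_eq_same,
    add_zero]
  linear_combination -CharTwo.add_self_eq_zero (low (bits m (i.rev : ℕ)) β₂)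

theorem gen_lastTerms (hm : 5 ≤ m) (g : BoolFun m) (s : ℤ) (a : Fin (k + 1) → ZMod 2) (n : ℕ) :
    gen s (lastTerms (gam m) (sShift p β₂ g a n)) =
      C (sgn (1 - a (Fin.last k))) * T (s * (gam m - 1)) *
        gen (-s) (firstTerms (gam m) (gShift p β₂ g (flipLast a) n)) := by
  rw [← gen_rev]
  congr 1
  exact funext fun i => lastTerms_sShift p β₂ hm g a n i

/-- Translating `a` by `(n + n', 1)` interchanges the two generating polynomials and reverses the
sign in front. Both have the same `s` because reversal has already negated the exponents of one. -/
theorem sum_gen_mul_gen_flipLast (g : BoolFun m) (s : ℤ) (n n' : ℕ) :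
    ∑ a, C (sgn (1 - a (Fin.last k))) * (gen s (firstTerms (gam m) (gShift p β₂ g a n)) *
      gen s (firstTerms (gam m) (gShift p β₂ g (flipLast a) n'))) = 0 := by
  let e : Fin (k + 1) → ZMod 2 := Fin.snoc (fun i => bits k n i + bits k n' i) 1
  have h1 : ∀ a, gShift p β₂ g (a + e) n = gShift p β₂ g (flipLast a) n' := by
    intro a
    ext z
    have h : ∀ x : Fin k, a x.castSucc + (bits k n x + bits k n' x) + bits k n x =
        a x.castSucc + bits k n' x := fun x => by
      linear_combination CharTwo.add_self_eq_zero (bits k n x)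
    simp [gShift, flipLast, e, h]
  have h2 : ∀ a, gShift p β₂ g (flipLast (a + e)) n' = gShift p β₂ g a n := by
    intro a
    ext z
    have h : ∀ x : Fin k, a x.castSucc + (bits k n x + bits k n' x) + bits k n' x =
        a x.castSucc + bits k n x := fun x => by
      linear_combination CharTwo.add_self_eq_zero (bits k n' x)
    simp [gShift, flipLast, e, h, add_assoc, CharTwo.add_self_eq_zero (1 : ZMod 2)]
  refine sum_eq_zero_of_translate_neg e _ fun a => ?_
  have h4 : sgn (1 - (a + e) (Fin.last k)) = -sgn (1 - a (Fin.last k)) := by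
    rw [← sgn_add_one]
    congr 1
    simp only [e, Pi.add_apply, Fin.snoc_last]
    linear_combination -CharTwo.add_self_eq_zero (1 : ZMod 2)
  rw [h1, h2, h4, map_neg]
  ring

end Construction

/-! ### Code sets from correlation polynomials -/

theorem isZCCS_range {κ ι : Type*} [Fintype κ] [Fintype ι] {l N : ℕ} (hl : 0 < l)
    (hN : 0 < N) (c : ι → κ → Fin (3 * l) → ℂ) (hreal : ∀ i a j, star (c i a j) = c i a j)
    (hκ : Fintype.card κ = N) (hι : Fintype.card ι = N)
    (hself : ∀ i, ∑ a, gen (-1) (c i a) * gen 1 (c i a) =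
      (3 - T (2 * (l : ℤ)) - T (-(2 * (l : ℤ)))) * C ((N : ℂ) * l))
    (hcross : ∀ i i', i ≠ i' → ∑ a, gen (-1) (c i a) * gen 1 (c i' a) = 0) :
    IsZCCS N N (3 * l) (2 * l) (Set.range c) := by
  have hcoeff : ∀ i (τ : ℤ), |τ| < (2 * l : ℕ) → codeCorr (c i) (c i) τ =
      if τ = 0 then (N : ℂ) * (3 * l : ℕ) else 0 := by
    intro i τ hτ
    rw [abs_lt] at hτ
    push_cast at hτ
    have h3 : (3 : LaurentPolynomial ℂ) = (3 : ℂ) • T 0 := by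
      rw [smul_eq_C_mul, T_zero, mul_one, map_ofNat]
    rw [codeCorr_eq_coeff _ _ (hreal i), hself, mul_comm, ← smul_eq_C_mul, h3]
    simp only [AddMonoidAlgebra.coeff_smul, AddMonoidAlgebra.coeff_sub, Finsupp.smul_apply,
      Finsupp.sub_apply, T_apply]
    rw [if_neg (show ¬ 2 * (l : ℤ) = τ by omega), if_neg (show ¬ -(2 * (l : ℤ)) = τ by omega)]
    by_cases h : τ = 0
    · simp only [h, if_true, smul_eq_mul]
      push_cast
      ring
    · simp [h, Ne.symm h]
  have hzero : ∀ i i' τ, i ≠ i' → codeCorr (c i) (c i') τ = 0 := by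
    intro i i' τ h
    rw [codeCorr_eq_coeff _ _ (hreal i'), hcross i i' h]
    rfl
  -- Distinct indices give distinct codes: equal ones would have correlation `N * 3l ≠ 0` at shift
  -- zero, yet cross-correlations vanish. The cardinality follows.
  have hinj : Function.Injective c := by
    intro i i' h
    by_contra hne
    have h1 := hzero i i' 0 hne
    rw [← h, hcoeff i 0 (by simpa using hl), if_pos rfl] at h1
    have : ((N * (3 * l) : ℕ) : ℂ) ≠ 0 := Nat.cast_ne_zero.mpr (by positivity)
    exact this (by exact_mod_cast h1)
  refine ⟨?_, hκ, ?_⟩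
  · rw [← Set.image_univ, hinj.encard_image, Set.encard_univ, ENat.card_eq_coe_fintype_card, hι]
  · rintro _ ⟨i, rfl⟩ _ ⟨i', rfl⟩ τ
    refine ⟨?_, ?_, ?_⟩
    · rintro h rfl
      rw [← h, hcoeff i 0 (by simpa using hl), if_pos rfl]
    · intro h h0 hτ
      rw [← h, hcoeff i τ hτ, if_neg (abs_pos.mp h0)]
    · intro h _
      exact hzero i i' τ fun h' => h (by rw [h'])

theorem seqTerm_eq_one_or {m : ℕ} (f : BoolFun m) (r : ℕ) : seqTerm f r = 1 ∨ seqTerm f r = -1 := by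
  rw [seqTerm_eq_sgn]
  exact sgn_eq_one_or _

theorem tripled_eq_one_or {l : ℕ} (x : Fin l → ℂ) (hx : ∀ i, x i = 1 ∨ x i = -1)
    (i : Fin (3 * l)) : tripled x i = 1 ∨ tripled x i = -1 := by
  have h : ∀ b : Fin 3, (![1, 1, -1] : Fin 3 → ℂ) b = 1 ∨ (![1, 1, -1] : Fin 3 → ℂ) b = -1 := by
    intro b; fin_cases b <;> simp
  rw [tripled]
  rcases h i.divNat with h | h <;> rcases hx i.modNat with h' | h' <;> simp [h, h']

theorem star_eq_self_of_eq_one_or {z : ℂ} (h : z = 1 ∨ z = -1) : star z = z := by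
  rcases h with rfl | rfl <;> simp

/-! ### Correlations within and between the two halves of the code set. -/

section Construction

variable {m k : ℕ} (p : Fin k → Fin (m - 4)) (β₂ : Fin (m - 4)) (g : BoolFun m)

/-- The two halves of the code set as one family. -/
noncomputable def codeFamily :
    Fin (2 ^ k) ⊕ Fin (2 ^ k) → (Fin (k + 1) → ZMod 2) → Fin (3 * gam m) → ℂ :=
  Sum.elim (fun n => codeC p β₂ g n) (fun n => codeCbar p β₂ g n)

theorem codeFamily_eq_one_or (i : Fin (2 ^ k) ⊕ Fin (2 ^ k)) (a : Fin (k + 1) → ZMod 2)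
    (j : Fin (3 * gam m)) : codeFamily p β₂ g i a j = 1 ∨ codeFamily p β₂ g i a j = -1 := by
  rcases i with n | n
  · exact tripled_eq_one_or _ (fun _ => seqTerm_eq_one_or _ _) j
  · exact tripled_eq_one_or _ (fun _ => seqTerm_eq_one_or _ _) j

theorem codeSet_eq_range : codeSet p β₂ g = Set.range (codeFamily p β₂ g) := by
  have h : (fun n => star (codeCbar p β₂ g n)) = fun n => codeCbar p β₂ g n := by
    funext n a j
    exact star_eq_self_of_eq_one_or (codeFamily_eq_one_or p β₂ g (Sum.inr n) a j)
  rw [codeSet, h, codeFamily, Set.Sum.elim_range]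

theorem gen_codeC (s : ℤ) (n : Fin (2 ^ k)) (a : Fin (k + 1) → ZMod 2) :
    gen s (codeFamily p β₂ g (Sum.inl n) a) =
      tripleFactor s (gam m) * gen s (firstTerms (gam m) (gShift p β₂ g a n)) :=
  gen_tripled s _

theorem gen_codeCbar (hm : 5 ≤ m) (s : ℤ) (n : Fin (2 ^ k)) (a : Fin (k + 1) → ZMod 2) :
    gen s (codeFamily p β₂ g (Sum.inr n) a) =
      tripleFactor s (gam m) * (C (sgn (1 - a (Fin.last k))) * T (s * (gam m - 1)) *
        gen (-s) (firstTerms (gam m) (gShift p β₂ g (flipLast a) n))) := by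
  rw [← gen_lastTerms p β₂ hm]
  exact gen_tripled s _

theorem sum_gen_codeC_codeCbar (hm : 5 ≤ m) (s : ℤ) (n n' : Fin (2 ^ k)) :
    ∑ a, gen s (codeFamily p β₂ g (Sum.inl n) a) *
      gen (-s) (codeFamily p β₂ g (Sum.inr n') a) = 0 := by
  simp only [gen_codeC, gen_codeCbar p β₂ g hm, neg_neg]
  have h := sum_gen_mul_gen_flipLast p β₂ g s n n'
  rw [← mul_zero (tripleFactor s (gam m) * tripleFactor (-s) (gam m) * T (-s * (gam m - 1))), ← h,
    Finset.mul_sum]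
  exact Finset.sum_congr rfl fun a _ => by ring

/-- Reversing both sequences exchanges their roles, hence the swap of `n` and `n'`; the signs square
to one, the monomials from reversal cancel, and the flip of `a` is absorbed by reindexing. -/
theorem sum_gen_codeCbar_codeCbar (hm : 5 ≤ m) (n n' : Fin (2 ^ k)) :
    ∑ a, gen (-1) (codeFamily p β₂ g (Sum.inr n) a) *
      gen 1 (codeFamily p β₂ g (Sum.inr n') a) =
    ∑ a, gen (-1) (codeFamily p β₂ g (Sum.inl n') a) *
      gen 1 (codeFamily p β₂ g (Sum.inl n) a) := by
  conv_rhs => rw [← Equiv.sum_comp (Equiv.addRight (Pi.single (Fin.last k) 1))]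
  refine Finset.sum_congr rfl fun a _ => ?_
  have h1 : C (sgn (1 - a (Fin.last k))) * C (sgn (1 - a (Fin.last k))) = 1 := by
    rw [← map_mul, sgn_mul_self, map_one]
  have h2 : (T (-1 * ((gam m : ℤ) - 1)) * T (1 * ((gam m : ℤ) - 1)) : LaurentPolynomial ℂ) = 1 := by
    rw [← T_add, ← add_mul, neg_add_cancel, zero_mul, T_zero]
  have hflip : a + Pi.single (Fin.last k) 1 = flipLast a := rfl
  simp only [gen_codeC, gen_codeCbar p β₂ g hm, neg_neg, Equiv.coe_addRight, hflip]
  calc _ = (C (sgn (1 - a (Fin.last k))) * C (sgn (1 - a (Fin.last k)))) *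
        (T (-1 * ((gam m : ℤ) - 1)) * T (1 * ((gam m : ℤ) - 1))) *
        (tripleFactor (-1) (gam m) *
          gen (-1) (firstTerms (gam m) (gShift p β₂ g (flipLast a) n')) *
        (tripleFactor 1 (gam m) *
          gen 1 (firstTerms (gam m) (gShift p β₂ g (flipLast a) n)))) := by ring
    _ = _ := by rw [h1, h2, one_mul, one_mul]

theorem sum_gen_codeC_codeC (hm : 5 ≤ m) (Q : QuadraticForm (ZMod 2) (Fin (m - 4) → ZMod 2))
    (β₁ : Fin (m - 4)) (d : Fin (m - 4) → ZMod 2) (d' : ZMod 2)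
    (hpath : IsPathAfterRemoving (graph Q) (Set.range p) β₁ β₂) (hp : Function.Injective p)
    (n n' : Fin (2 ^ k)) :
    ∑ a, gen (-1) (codeFamily p β₂ (gFun hm Q d d' β₁) (Sum.inl n) a) *
        gen 1 (codeFamily p β₂ (gFun hm Q d d' β₁) (Sum.inl n') a) =
      if n = n' then (3 - T (2 * (gam m : ℤ)) - T (-(2 * (gam m : ℤ)))) *
        C (((2 ^ (k + 1) : ℕ) : ℂ) * gam m) else 0 := by
  have h := sum_gen_firstTerms hm Q p β₁ β₂ d d' hpath hp n n'
  simp only [gen_codeC]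
  rw [Finset.sum_congr rfl fun a _ => mul_mul_mul_comm (tripleFactor (-1) (gam m)) _ _ _,
    ← Finset.mul_sum, h, tripleFactor_mul]
  split_ifs
  · push_cast; rfl
  · rw [mul_zero]

end Construction

end ZCS

theorem theorem3 (m k : ℕ) (hm : 5 ≤ m) (hk : k ≤ m - 5)
    (Q : QuadraticForm (ZMod 2) (Fin (m - 4) → ZMod 2))
    (p : Fin k → Fin (m - 4)) (hp : StrictMono p) (β₁ β₂ : Fin (m - 4))
    (hpath : ZCS.IsPathAfterRemoving (ZCS.graph Q) (Set.range p) β₁ β₂)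
    (d : Fin (m - 4) → ZMod 2) (d' : ZMod 2) :
    ZCS.IsBinary (ZCS.codeSet p β₂ (ZCS.gFun hm Q d d' β₁)) ∧
      ZCS.IsOptimalZCCS (2 ^ (k + 1)) (2 ^ (k + 1)) (3 * ZCS.gam m) (2 * ZCS.gam m)
        (ZCS.codeSet p β₂ (ZCS.gFun hm Q d d' β₁)) := by
  have hgam : 0 < ZCS.gam m := by rw [ZCS.gam]; positivity
  have hCC := ZCS.sum_gen_codeC_codeC p β₂ hm Q β₁ d d' hpath hp.injective
  rw [ZCS.codeSet_eq_range]
  refine ⟨?_, ?_, by omega, ?_⟩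
  · rintro _ ⟨i, rfl⟩ a j
    exact ZCS.codeFamily_eq_one_or _ _ _ i a j
  · refine ZCS.isZCCS_range hgam (by positivity) _
      (fun i a j => ZCS.star_eq_self_of_eq_one_or (ZCS.codeFamily_eq_one_or _ _ _ i a j))
      (by simp) (by simp [pow_succ, mul_two]) ?_ ?_
    · rintro (n | n)
      · rw [hCC, if_pos rfl]
      · rw [ZCS.sum_gen_codeCbar_codeCbar p β₂ _ hm, hCC, if_pos rfl]
    · rintro (n | n) (n' | n') hne
      · rw [hCC, if_neg fun h => hne (by rw [h])]
      · exact ZCS.sum_gen_codeC_codeCbar p β₂ _ hm (-1) n n'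
      -- The opposite order of the two halves is the mixed identity with `s = 1`, up to commuting
      -- the factors.
      · rw [← ZCS.sum_gen_codeC_codeCbar p β₂ (ZCS.gFun hm Q d d' β₁) hm 1 n' n]
        exact Finset.sum_congr rfl fun a _ => mul_comm _ _
      · rw [ZCS.sum_gen_codeCbar_codeCbar p β₂ _ hm, hCC, if_neg fun h => hne (by rw [h])]
  -- Optimality: `3γ / (2γ)` rounds down to `1`.
  · rw [Nat.div_eq_of_lt_le (k := 1) (by omega) (by omega), mul_one]
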